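/- For $h \ge 1$ let $\mathrm{BRecMAJ}_3^h : \{0,1\}^{3^h} \to \{0,1\}$ be the balanced recursive ternary majority function: $\mathrm{BRecMAJ}_3^1 = \mathrm{MAJ}_3$ is the majority function on three bits, and for $h \ge 2$ $$\mathrm{BRecMAJ}_3^h(x_1,\dots,x_{3^h}) = \mathrm{MAJ}_3\bigl(\mathrm{BRecMAJ}_3^{h-1}(x_1,\dots,x_{3^{h-1}}),\ \mathrm{BRecMAJ}_3^{h-1}(x_{3^{h-1}+1},\dots,x_{2\cdot 3^{h-1}}),\ \mathrm{BRecMAJ}_3^{h-1}(x_{2\cdot 3^{h-1}+1},\dots,x_{3^h})\bigr).$$ A monotone formula is a binary tree with leaves labelled by (unnegated) variables and internal nodes labelled by $\wedge$ or $\vee$; its size is its number of leaves. For a Boolean function $f$ computed by some monotone formula, let $L_m(f)$ be the smallest size of a monotone formula computing $f$. Then for every integer $h \ge 2$, $$L_m\bigl(\mathrm{BRecMAJ}_3^h\bigr) \ \ge\ 4^h + \frac{13}{36}\left(\frac{8}{3}\right)^h .$$ -/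

import Mathlib

/-- Formulas over the variables `x_0, …, x_{n-1}`: binary trees whose leaves are labelled by
literals (a variable or the negation of a variable) and whose internal nodes are labelled
by conjunction or disjunction. -/
inductive BoolFormula (n : ℕ) : Type where
  | var (i : Fin n) : BoolFormula n
  | negVar (i : Fin n) : BoolFormula n
  | conj (φ ψ : BoolFormula n) : BoolFormula n
  | disj (φ ψ : BoolFormula n) : BoolFormula n

namespace BoolFormula

/-- The value of a formula on an input. -/
def eval {n : ℕ} : BoolFormula n → (Fin n → Bool) → Bool
  | var i, x => x i
  | negVar i, x => !(x i)
  | conj φ ψ, x => φ.eval x && ψ.eval x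
  | disj φ ψ, x => φ.eval x || ψ.eval x

/-- The size of a formula: its number of leaves. -/
def size {n : ℕ} : BoolFormula n → ℕ
  | var _ => 1
  | negVar _ => 1
  | conj φ ψ => φ.size + ψ.size
  | disj φ ψ => φ.size + ψ.size

/-- A formula is monotone if it contains no negations. -/
def IsMonotone {n : ℕ} : BoolFormula n → Prop
  | var _ => True
  | negVar _ => False
  | conj φ ψ => φ.IsMonotone ∧ ψ.IsMonotone
  | disj φ ψ => φ.IsMonotone ∧ ψ.IsMonotone

/-- The formula computes the Boolean function `f`. -/
def Computes {n : ℕ} (φ : BoolFormula n) (f : (Fin n → Bool) → Bool) : Prop :=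
  ∀ x, φ.eval x = f x

end BoolFormula

/-- The monotone formula size of `f`: the size of a smallest monotone formula computing `f`.
(The value is `0` exactly when no monotone formula computes `f`, since every formula has at
least one leaf.) -/
noncomputable def monotoneFormulaSize {n : ℕ} (f : (Fin n → Bool) → Bool) : ℕ :=
  sInf {s : ℕ | ∃ φ : BoolFormula n, φ.IsMonotone ∧ φ.Computes f ∧ φ.size = s}

/-- The majority function on `2 * l + 1` bits: `true` iff at least `l + 1` bits are `true`. -/
def majority (l : ℕ) (x : Fin (2 * l + 1) → Bool) : Bool :=
  decide (l + 1 ≤ (Finset.univ.filter fun i => x i = true).card)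

/-- Position `i` of the `k`-th of the three consecutive blocks of length `3 ^ h`. -/
def blockIndex (h : ℕ) (k : Fin 3) (i : Fin (3 ^ h)) : Fin (3 ^ (h + 1)) :=
  ⟨k.val * 3 ^ h + i.val, by
    have hk := Nat.mul_le_mul_right (3 ^ h) (Nat.le_of_lt_succ k.isLt)
    have hi := i.isLt
    rw [pow_succ]
    omega⟩

/-- The balanced recursive ternary majority function of height `h` on `3 ^ h` bits: the
majority of the three values of the function of height `h - 1` on the three consecutive
blocks of the input. At height `0` it is the identity of one bit, so that at height `1` it is
the majority function on three bits (`brecMaj_one`). -/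
def brecMaj : (h : ℕ) → (Fin (3 ^ h) → Bool) → Bool
  | 0, x => x ⟨0, Nat.one_pos⟩
  | h + 1, x => majority 1 fun k : Fin 3 => brecMaj h fun i => x (blockIndex h k i)

theorem brecMaj_one (x : Fin (3 ^ 1) → Bool) : brecMaj 1 x = majority 1 x := by
  have hx : (fun k : Fin 3 => x (blockIndex 0 k ⟨0, Nat.one_pos⟩)) = x := by
    funext k
    congr 1
    ext
    simp [blockIndex]
  exact congrArg (majority 1) hx

/-! A monotone formula with `L` leaves splits accepted × rejected inputs into `L` rectangles, each
with a variable separating its pairs. Restrict to critical inputs indexed by `s, t : Fin h → Fin 3`: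
the ternary digits of the separating leaf avoid `s j` and `t j` at every `j`. On the `6 ^ h` cells
with `s j ≠ t j` throughout, the leaf and the row determine the column, and conversely. A rectangle
with `e` such cells thus has them in distinct rows and columns, so contains at least `e ^ 2` of the
`9 ^ h` cells; Cauchy–Schwarz yields `4 ^ h`.

The second term comes from cells that this count wastes. Among the three cells that agree off one
coordinate and have `s l = t l = a` there, one is never counted: otherwise all three share a leaf,
whose digit at `l` would avoid all of `Fin 3`. This saves `h * 6 ^ (h - 1)` cells. -/

namespace BoolFormula

/-! ### Rectangle partitions from monotone formulas -/

/-- The leaves of a monotone formula label the pairs (accepted input, rejected input), with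
rectangular fibres, such that the variable at the leaf separates the pair. -/
theorem exists_rectangle_labelling {n : ℕ} (φ : BoolFormula n) (hφ : φ.IsMonotone) :
    ∃ (ι : Type) (_ : Fintype ι) (ℓ : (Fin n → Bool) → (Fin n → Bool) → ι) (v : ι → Fin n),
      Fintype.card ι = φ.size ∧
      (∀ x y, φ.eval x = true → φ.eval y = false →
        x (v (ℓ x y)) = true ∧ y (v (ℓ x y)) = false) ∧
      ∀ x x' y y', φ.eval x = true → φ.eval x' = true → φ.eval y = false → φ.eval y' = false →
        ℓ x y = ℓ x' y' → ℓ x y' = ℓ x y := by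
  induction φ with
  | var i => exact ⟨Unit, inferInstance, fun _ _ => (), fun _ => i, rfl,
      fun x y hx hy => ⟨hx, hy⟩, fun _ _ _ _ _ _ _ _ _ => rfl⟩
  | negVar i => exact hφ.elim
  | conj φ ψ ihφ ihψ =>
    obtain ⟨ι, _, ℓ, v, hc, hs, hr⟩ := ihφ hφ.1
    obtain ⟨κ, _, m, w, hc', hs', hr'⟩ := ihψ hφ.2
    -- The choice of subformula depends on the rejected input alone, so fibres stay rectangular; for
    -- a disjunction it depends on the accepted input alone.
    refine ⟨ι ⊕ κ, inferInstance,
      fun x y => if φ.eval y = false then .inl (ℓ x y) else .inr (m x y), Sum.elim v w, ?_, ?_, ?_⟩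
    · simp [size, hc, hc']
    · intro x y hx hy
      simp only [eval, Bool.and_eq_true, Bool.and_eq_false_iff] at hx hy
      by_cases h : φ.eval y = false
      · simpa [h] using hs x y hx.1 h
      · simpa [h] using hs' x y hx.2 (hy.resolve_left h)
    · intro x x' y y' hx hx' hy hy'
      simp only [eval, Bool.and_eq_true, Bool.and_eq_false_iff] at hx hx' hy hy'
      by_cases h : φ.eval y = false <;> by_cases h' : φ.eval y' = false
      · simpa [h, h'] using hr x x' y y' hx.1 hx'.1 h h'
      · simp [h, h']
      · simp [h, h']
      · simpa [h, h'] using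
          hr' x x' y y' hx.2 hx'.2 (hy.resolve_left h) (hy'.resolve_left h')
  | disj φ ψ ihφ ihψ =>
    obtain ⟨ι, _, ℓ, v, hc, hs, hr⟩ := ihφ hφ.1
    obtain ⟨κ, _, m, w, hc', hs', hr'⟩ := ihψ hφ.2
    refine ⟨ι ⊕ κ, inferInstance,
      fun x y => if φ.eval x = true then .inl (ℓ x y) else .inr (m x y), Sum.elim v w, ?_, ?_, ?_⟩
    · simp [size, hc, hc']
    · intro x y hx hy
      simp only [eval, Bool.or_eq_true, Bool.or_eq_false_iff] at hx hy
      by_cases h : φ.eval x = true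
      · simpa [h] using hs x y h hy.1
      · simpa [h] using hs' x y (hx.resolve_left h) hy.2
    · intro x x' y y' hx hx' hy hy'
      simp only [eval, Bool.or_eq_true, Bool.or_eq_false_iff] at hx hx' hy hy'
      by_cases h : φ.eval x = true <;> by_cases h' : φ.eval x' = true
      · simpa [h, h'] using hr x x' y y' h h' hy.1 hy'.1
      · simp [h, h']
      · simp [h, h']
      · simpa [h, h'] using
          hr' x x' y y' (hx.resolve_left h) (hx'.resolve_left h') hy.2 hy'.2

/-! ### Monotone formulas for recursive majority -/

/-- Renaming the variables of a formula. -/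
def rename {n m : ℕ} (f : Fin n → Fin m) : BoolFormula n → BoolFormula m
  | var i => var (f i)
  | negVar i => negVar (f i)
  | conj φ ψ => conj (φ.rename f) (ψ.rename f)
  | disj φ ψ => disj (φ.rename f) (ψ.rename f)

theorem eval_rename {n m : ℕ} (f : Fin n → Fin m) (φ : BoolFormula n) (x : Fin m → Bool) :
    (φ.rename f).eval x = φ.eval fun i => x (f i) := by
  induction φ <;> simp_all [rename, eval]

theorem IsMonotone.rename {n m : ℕ} (f : Fin n → Fin m) {φ : BoolFormula n}
    (hφ : φ.IsMonotone) : (φ.rename f).IsMonotone := by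
  induction φ with
  | var i => trivial
  | negVar i => exact hφ.elim
  | conj φ ψ ihφ ihψ => exact ⟨ihφ hφ.1, ihψ hφ.2⟩
  | disj φ ψ ihφ ihψ => exact ⟨ihφ hφ.1, ihψ hφ.2⟩

end BoolFormula

theorem majority_one_eq (f : Fin 3 → Bool) :
    majority 1 f = ((f 0 && f 1) || (f 2 && (f 0 || f 1))) := by
  revert f
  decide

theorem majority_one_of_forall_ne (f : Fin 3 → Bool) (a : Fin 3) (b : Bool)
    (hf : ∀ k, k ≠ a → f k = b) : majority 1 f = b := by
  revert f a b
  decide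

/-- Needed because `sInf ∅ = 0`: without a monotone formula the lower bound would be false. -/
theorem exists_isMonotone_computes_brecMaj (h : ℕ) :
    ∃ φ : BoolFormula (3 ^ h), φ.IsMonotone ∧ φ.Computes (brecMaj h) := by
  induction h with
  | zero => exact ⟨.var (n := 3 ^ 0) ⟨0, Nat.one_pos⟩, trivial, fun x => rfl⟩
  | succ h ih =>
    obtain ⟨φ, hφ, hc⟩ := ih
    have hm (k : Fin 3) : (φ.rename (blockIndex h k)).IsMonotone := hφ.rename _
    refine ⟨.disj (.conj (φ.rename (blockIndex h 0)) (φ.rename (blockIndex h 1)))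
      (.conj (φ.rename (blockIndex h 2))
        (.disj (φ.rename (blockIndex h 0)) (φ.rename (blockIndex h 1)))),
      ⟨⟨hm 0, hm 1⟩, hm 2, hm 0, hm 1⟩, fun x => ?_⟩
    simp only [BoolFormula.eval, BoolFormula.eval_rename, brecMaj, majority_one_eq]
    simp only [hc _]

theorem exists_isMonotone_size_eq_monotoneFormulaSize (h : ℕ) :
    ∃ φ : BoolFormula (3 ^ h), φ.IsMonotone ∧ φ.Computes (brecMaj h) ∧
      φ.size = monotoneFormulaSize (brecMaj h) := by
  obtain ⟨φ, hφ, hc⟩ := exists_isMonotone_computes_brecMaj h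
  have hne : {s : ℕ | ∃ φ : BoolFormula (3 ^ h),
      φ.IsMonotone ∧ φ.Computes (brecMaj h) ∧ φ.size = s}.Nonempty := ⟨φ.size, φ, hφ, hc, rfl⟩
  exact Nat.sInf_mem hne

/-! ### Critical inputs -/

/-- The ternary digits of a leaf, the most significant one first. -/
def ternaryDigits : (h : ℕ) → Fin (3 ^ h) → Fin h → Fin 3
  | 0, _ => Fin.elim0
  | h + 1, i => Fin.cons (α := fun _ => Fin 3)
      ⟨i.val / 3 ^ h, Nat.div_lt_of_lt_mul (i.isLt.trans_eq (pow_succ 3 h))⟩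
      (ternaryDigits h ⟨i.val % 3 ^ h, Nat.mod_lt _ (by positivity)⟩)

theorem ternaryDigits_blockIndex (h : ℕ) (k : Fin 3) (i : Fin (3 ^ h)) :
    ternaryDigits (h + 1) (blockIndex h k i) = Fin.cons k (ternaryDigits h i) := by
  have hp : 0 < 3 ^ h := by positivity
  have h1 : (k.val * 3 ^ h + i.val) / 3 ^ h = k.val := by
    rw [mul_comm, Nat.mul_add_div hp, Nat.div_eq_of_lt i.isLt, add_zero]
  have h2 : (k.val * 3 ^ h + i.val) % 3 ^ h = i.val := by
    rw [mul_comm, Nat.mul_add_mod, Nat.mod_eq_of_lt i.isLt]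
  simp only [ternaryDigits, blockIndex, h1, h2]

/-- An input on which `brecMaj` is `b`: a leaf has value `b` iff its digits avoid `s`. -/
def avoidingInput {h : ℕ} (b : Bool) (s : Fin h → Fin 3) (i : Fin (3 ^ h)) : Bool :=
  if ∀ j, ternaryDigits h i j ≠ s j then b else !b

theorem avoidingInput_eq_iff {h : ℕ} (b : Bool) (s : Fin h → Fin 3) (i : Fin (3 ^ h)) :
    avoidingInput b s i = b ↔ ∀ j, ternaryDigits h i j ≠ s j := by
  unfold avoidingInput
  split_ifs with hs
  · exact iff_of_true rfl hs
  · exact iff_of_false (by cases b <;> decide) hs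

theorem brecMaj_avoidingInput {h : ℕ} (b : Bool) (s : Fin h → Fin 3) :
    brecMaj h (avoidingInput b s) = b := by
  induction h with
  | zero => exact (avoidingInput_eq_iff b s _).2 fun j => j.elim0
  | succ h ih =>
    refine majority_one_of_forall_ne _ (s 0) b fun k hk => ?_
    refine Eq.trans (congrArg _ (funext fun i => ?_)) (ih (Fin.tail s))
    have hiff : (∀ j, ternaryDigits (h + 1) (blockIndex h k i) j ≠ s j) ↔
        ∀ j, ternaryDigits h i j ≠ Fin.tail s j := by
      rw [ternaryDigits_blockIndex, Fin.forall_fin_succ]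
      simp [Fin.tail, hk]
    exact if_congr hiff rfl rfl

/-! ### Counting cells in rectangles -/

section RectangleCounting

/-- Ordered pairs of distinct elements of `Fin 3`. -/
abbrev OffDiagPair : Type := {p : Fin 3 × Fin 3 // p.1 ≠ p.2}

theorem card_offDiagPair : Fintype.card OffDiagPair = 6 := by decide

variable {h : ℕ} {ι : Type}

/-- The row of a cell all of whose coordinates are off the diagonal. -/
def offDiagRow (c : Fin h → OffDiagPair) (j : Fin h) : Fin 3 := (c j).1.1

/-- The column of a cell all of whose coordinates are off the diagonal. -/
def offDiagCol (c : Fin h → OffDiagPair) (j : Fin h) : Fin 3 := (c j).1.2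

/-- Extends a vector given off the coordinate `l` by the value `a` at `l`. -/
def extendAt (l : Fin h) (u : {j // j ≠ l} → Fin 3) (a : Fin 3) (j : Fin h) : Fin 3 :=
  if hj : j = l then a else u ⟨j, hj⟩

theorem extendAt_self (l : Fin h) (u : {j // j ≠ l} → Fin 3) (a : Fin 3) :
    extendAt l u a l = a := by
  simp [extendAt]

theorem extendAt_of_ne (l : Fin h) (u : {j // j ≠ l} → Fin 3) (a : Fin 3) {j : Fin h}
    (hj : j ≠ l) : extendAt l u a j = u ⟨j, hj⟩ := by
  simp [extendAt, hj]

/-- A coordinate `l` with an off-diagonal pair at every other coordinate. -/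
abbrev PuncturedCell (h : ℕ) : Type := Σ l : Fin h, ({j // j ≠ l} → OffDiagPair)

theorem card_puncturedCell (h : ℕ) : Fintype.card (PuncturedCell h) = h * 6 ^ (h - 1) := by
  simp only [Fintype.card_sigma, Fintype.card_fun, card_offDiagPair]
  simp [Fintype.card_subtype_compl]

/-- The row obtained by filling the punctured coordinate. -/
def PuncturedCell.row (q : PuncturedCell h) : Fin 3 → Fin h → Fin 3 :=
  extendAt q.1 fun j => (q.2 j).1.1

/-- The column obtained by filling the punctured coordinate. -/
def PuncturedCell.col (q : PuncturedCell h) : Fin 3 → Fin h → Fin 3 :=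
  extendAt q.1 fun j => (q.2 j).1.2

theorem PuncturedCell.row_eq_col_iff (q : PuncturedCell h) (a : Fin 3) (j : Fin h) :
    q.row a j = q.col a j ↔ j = q.1 := by
  by_cases hj : j = q.1
  · subst hj
    simp [row, col, extendAt_self]
  · simp only [row, col, extendAt_of_ne _ _ _ hj, hj, iff_false]
    exact (q.2 ⟨j, hj⟩).2

theorem PuncturedCell.eq_of_row_eq_of_col_eq {q q' : PuncturedCell h} {a a' : Fin 3}
    (hr : q.row a = q'.row a') (hc : q.col a = q'.col a') : q = q' := by
  obtain ⟨l, u⟩ := q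
  obtain ⟨l', u'⟩ := q'
  have hl : l = l' := by
    have := (row_eq_col_iff ⟨l, u⟩ a l).2 rfl
    rw [hr, hc] at this
    exact (row_eq_col_iff ⟨l', u'⟩ a' l).1 this
  subst hl
  congr 1
  funext j
  have h1 := congrFun hr j.1
  have h2 := congrFun hc j.1
  simp only [row, col, extendAt_of_ne _ _ _ j.2] at h1 h2
  exact Subtype.ext (Prod.ext h1 h2)

theorem Fin.three_eq_of_ne {a b b' i : Fin 3} (hab : a ≠ b) (hab' : a ≠ b') (ha : i ≠ a)
    (hb : i ≠ b) (hb' : i ≠ b') : b = b' := by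
  omega

/-- A fixed-point-free map on three points has a connected functional graph. -/
theorem Fin.apply_eq_apply_zero_of_apply_ne {α : Type*} (f : Fin 3 → α) (g : Fin 3 → Fin 3)
    (hg : ∀ a, g a ≠ a) (hf : ∀ a, f (g a) = f a) (a : Fin 3) : f a = f 0 := by
  have h0 := hf 0
  have h1 := hf 1
  have h2 := hf 2
  rcases (by have := hg 0; omega : g 0 = 1 ∨ g 0 = 2) with e0 | e0 <;>
  rcases (by have := hg 1; omega : g 1 = 0 ∨ g 1 = 2) with e1 | e1 <;>
  rcases (by have := hg 2; omega : g 2 = 0 ∨ g 2 = 1) with e2 | e2 <;>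
  rw [e0] at h0 <;> rw [e1] at h1 <;> rw [e2] at h2 <;>
  (rcases (by omega : a = 0 ∨ a = 1 ∨ a = 2) with rfl | rfl | rfl) <;> grind

variable (ℓ : (Fin h → Fin 3) → (Fin h → Fin 3) → ι) (d : ι → Fin h → Fin 3)

/-- The pairs of off-diagonal cells with the same label inject into the cells, and for every
punctured cell the image misses one of its three fillings. -/
theorem card_pairs_add_card_puncturedCell_le [DecidableEq ι]
    (hd : ∀ s t j, d (ℓ s t) j ≠ s j ∧ d (ℓ s t) j ≠ t j)
    (hrect : ∀ s s' t t', ℓ s t = ℓ s' t' → ℓ s t' = ℓ s t) :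
    Fintype.card {p : (Fin h → OffDiagPair) × (Fin h → OffDiagPair) //
        ℓ (offDiagRow p.1) (offDiagCol p.1) = ℓ (offDiagRow p.2) (offDiagCol p.2)} +
      h * 6 ^ (h - 1) ≤ 9 ^ h := by
  set Q := {p : (Fin h → OffDiagPair) × (Fin h → OffDiagPair) //
    ℓ (offDiagRow p.1) (offDiagCol p.1) = ℓ (offDiagRow p.2) (offDiagCol p.2)}
  -- By rectangularity this mixed cell keeps the common label of the pair.
  let F : Q → (Fin h → Fin 3) × (Fin h → Fin 3) := fun p =>
    (offDiagRow p.1.1, offDiagCol p.1.2)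
  have hlab (p : Q) : ℓ (F p).1 (F p).2 = ℓ (offDiagRow p.1.1) (offDiagCol p.1.1) :=
    hrect _ _ _ _ p.2
  have hF : Function.Injective F := by
    intro p q hpq
    have h1 : offDiagRow p.1.1 = offDiagRow q.1.1 := congrArg Prod.fst hpq
    have h2 : offDiagCol p.1.2 = offDiagCol q.1.2 := congrArg Prod.snd hpq
    have hl : ℓ (offDiagRow p.1.1) (offDiagCol p.1.1) =
        ℓ (offDiagRow q.1.1) (offDiagCol q.1.1) := by
      rw [← hlab, ← hlab, hpq]
    have hl' : ℓ (offDiagRow p.1.2) (offDiagCol p.1.2) =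
        ℓ (offDiagRow q.1.2) (offDiagCol q.1.2) := by
      rw [← p.2, ← q.2, hl]
    refine Subtype.ext (Prod.ext (funext fun j => ?_) (funext fun j => ?_))
    · have e := congrFun h1 j
      refine Subtype.ext (Prod.ext e ?_)
      have hp := hd (offDiagRow p.1.1) (offDiagCol p.1.1) j
      have hq := hd (offDiagRow q.1.1) (offDiagCol q.1.1) j
      rw [← hl] at hq
      exact Fin.three_eq_of_ne (p.1.1 j).2 (e.trans_ne (q.1.1 j).2) hp.1 hp.2 hq.2
    · have e := congrFun h2 j
      refine Subtype.ext (Prod.ext ?_ e)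
      have hp := hd (offDiagRow p.1.2) (offDiagCol p.1.2) j
      have hq := hd (offDiagRow q.1.2) (offDiagCol q.1.2) j
      rw [← hl'] at hq
      exact Fin.three_eq_of_ne (p.1.2 j).2.symm (e.trans_ne (q.1.2 j).2.symm) hp.2 hp.1 hq.1
  have hmiss (q : PuncturedCell h) : ∃ a, ∀ p, F p ≠ (q.row a, q.col a) := by
    by_contra! hcon
    -- If `(c, c')` maps to filling `a`, the opposite corner (row of `c'`, column of `c`) has the
    -- same label. Avoiding the label's digits forces it to agree with `q` off the puncture, and its
    -- row and column there to be the same `b ≠ a`.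
    have hstep (a : Fin 3) : ∃ b, b ≠ a ∧ ℓ (q.row b) (q.col b) = ℓ (q.row a) (q.col a) := by
      obtain ⟨p, hp⟩ := hcon a
      have h1 : offDiagRow p.1.1 = q.row a := congrArg Prod.fst hp
      have h2 : offDiagCol p.1.2 = q.col a := congrArg Prod.snd hp
      have hL : ℓ (q.row a) (q.col a) = ℓ (offDiagRow p.1.1) (offDiagCol p.1.1) := by
        rw [← hlab, hp]
      have hL' : ℓ (q.row a) (q.col a) = ℓ (offDiagRow p.1.2) (offDiagCol p.1.2) :=
        hL.trans p.2
      have d0 := hd (q.row a) (q.col a)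
      have d1 := hd (offDiagRow p.1.1) (offDiagCol p.1.1)
      have d2 := hd (offDiagRow p.1.2) (offDiagCol p.1.2)
      rw [← hL] at d1
      rw [← hL'] at d2
      have n1 (j) : q.row a j ≠ offDiagCol p.1.1 j := by
        rw [← h1]; exact (p.1.1 j).2
      have n2 (j) : q.col a j ≠ offDiagRow p.1.2 j := by
        rw [← h2]; exact (p.1.2 j).2.symm
      have ha : q.row a q.1 = a := extendAt_self _ _ _
      have ha' : q.col a q.1 = a := extendAt_self _ _ _
      have hcol : q.col (offDiagCol p.1.1 q.1) = offDiagCol p.1.1 := by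
        funext j
        by_cases hj : j = q.1
        · subst hj
          exact extendAt_self _ _ _
        · have hne : q.row a j ≠ q.col a j := mt (q.row_eq_col_iff a j).1 hj
          have : q.col (offDiagCol p.1.1 q.1) j = q.col a j := by
            simp only [PuncturedCell.col, extendAt_of_ne _ _ _ hj]
          rw [this]
          exact Fin.three_eq_of_ne hne (n1 j) (d0 j).1 (d0 j).2 (d1 j).2
      have hrow : q.row (offDiagCol p.1.1 q.1) = offDiagRow p.1.2 := by
        funext j
        by_cases hj : j = q.1
        · subst hj
          refine (extendAt_self _ _ _).trans ?_
          refine Fin.three_eq_of_ne (n1 _) ?_ (d0 _).1 (d1 _).2 (d2 _).1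
          rw [ha, ← ha']
          exact n2 _
        · have hne : q.row a j ≠ q.col a j := mt (q.row_eq_col_iff a j).1 hj
          have : q.row (offDiagCol p.1.1 q.1) j = q.row a j := by
            simp only [PuncturedCell.row, extendAt_of_ne _ _ _ hj]
          rw [this]
          exact Fin.three_eq_of_ne hne.symm (n2 j) (d0 j).2 (d0 j).1 (d2 j).1
      refine ⟨offDiagCol p.1.1 q.1, ?_, ?_⟩
      · have := n1 q.1
        rw [ha] at this
        exact this.symm
      · rw [hcol, hrow, hL', ← hrect _ _ _ _ p.2.symm]
    choose g hg hgl using hstep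
    have hall (a : Fin 3) : ℓ (q.row a) (q.col a) = ℓ (q.row 0) (q.col 0) :=
      Fin.apply_eq_apply_zero_of_apply_ne (fun a => ℓ (q.row a) (q.col a)) g hg hgl a
    -- Filling the puncture with the common label's own digit contradicts avoidance.
    set i := d (ℓ (q.row 0) (q.col 0)) q.1
    have := (hd (q.row i) (q.col i) q.1).1
    rw [hall] at this
    exact this (extendAt_self _ _ _).symm
  choose a ha using hmiss
  have hinj : Function.Injective
      (Sum.elim F fun q : PuncturedCell h => (q.row (a q), q.col (a q))) := by
    refine hF.sumElim (fun q q' hq => ?_) fun p q => ha q p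
    exact PuncturedCell.eq_of_row_eq_of_col_eq (congrArg Prod.fst hq) (congrArg Prod.snd hq)
  have hle := Fintype.card_le_of_injective _ hinj
  rw [Fintype.card_sum, card_puncturedCell] at hle
  refine hle.trans_eq ?_
  simp [← mul_pow]

/-- A rectangular labelling of the cells whose labels avoid rows and columns uses many labels. -/
theorem le_card_of_rectangle_labelling [Fintype ι]
    (hd : ∀ s t j, d (ℓ s t) j ≠ s j ∧ d (ℓ s t) j ≠ t j)
    (hrect : ∀ s s' t t', ℓ s t = ℓ s' t' → ℓ s t' = ℓ s t) :
    (4 : ℝ) ^ h + h / 6 * (8 / 3 : ℝ) ^ h ≤ Fintype.card ι := by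
  classical
  let lab : (Fin h → OffDiagPair) → ι := fun c => ℓ (offDiagRow c) (offDiagCol c)
  let e : ι → ℕ := fun r => (Finset.univ.filter fun c => lab c = r).card
  have hsum : ∑ r, e r = 6 ^ h := by
    rw [← Finset.card_eq_sum_card_fiberwise (f := lab) (fun _ _ => Finset.mem_univ _)]
    rw [Finset.card_univ, Fintype.card_fun, card_offDiagPair, Fintype.card_fin]
  have hsq : ∑ r, e r ^ 2 + h * 6 ^ (h - 1) ≤ 9 ^ h := by
    refine le_trans (le_of_eq ?_) (card_pairs_add_card_puncturedCell_le ℓ d hd hrect)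
    rw [Fintype.card_subtype,
      Finset.card_eq_sum_card_fiberwise (f := fun p => lab p.1) (t := Finset.univ)
        (fun _ _ => Finset.mem_univ _)]
    congr 1
    refine Finset.sum_congr rfl fun r _ => ?_
    rw [sq, ← Finset.card_product]
    congr 1
    ext p
    simp only [Finset.mem_product, Finset.mem_filter, Finset.mem_univ, true_and]
    exact ⟨fun hp => ⟨hp.1.trans hp.2.symm, hp.1⟩, fun hp => ⟨hp.2, hp.1.symm.trans hp.2⟩⟩
  have hsumR : ∑ r, (e r : ℝ) = 6 ^ h := by exact_mod_cast hsum
  have hsqR : ∑ r, (e r : ℝ) ^ 2 + h / 6 * 6 ^ h ≤ 9 ^ h := by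
    have h6 : (h : ℝ) / 6 * 6 ^ h = h * 6 ^ (h - 1) := by
      cases h with
      | zero => simp
      | succ k => rw [Nat.add_sub_cancel, pow_succ]; ring
    rw [h6]
    exact_mod_cast hsq
  -- Cauchy–Schwarz in tangent form, `1 ≥ 2 * t * e - t ^ 2 * e ^ 2`, with `1 / t = 9 ^ h / 6 ^ h`
  -- the value of `e` in the equality case of the basic bound.
  set t : ℝ := (2 / 3) ^ h with ht
  have hpoint : ∑ r, (2 * t * e r - t ^ 2 * (e r : ℝ) ^ 2) ≤ ∑ _r : ι, (1 : ℝ) :=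
    Finset.sum_le_sum fun r _ => by nlinarith [sq_nonneg (t * e r - 1)]
  rw [Finset.sum_sub_distrib, ← Finset.mul_sum, ← Finset.mul_sum, hsumR] at hpoint
  have h4 : t * 6 ^ h = 4 ^ h := by rw [ht, ← mul_pow]; norm_num
  have h9 : t ^ 2 * 9 ^ h = 4 ^ h := by rw [ht, ← pow_mul, mul_comm h, pow_mul, ← mul_pow]; norm_num
  have h8 : t ^ 2 * 6 ^ h = (8 / 3) ^ h := by
    rw [ht, ← pow_mul, mul_comm h, pow_mul, ← mul_pow]; norm_num
  have hmul := mul_le_mul_of_nonneg_left hsqR (sq_nonneg t)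
  simp only [Finset.sum_const, Finset.card_univ, nsmul_eq_mul, mul_one] at hpoint
  rw [← h8]
  linarith

end RectangleCounting

/-! ### The lower bound -/

theorem le_monotoneFormulaSize_brecMaj (h : ℕ) :
    (4 : ℝ) ^ h + h / 6 * (8 / 3 : ℝ) ^ h ≤ monotoneFormulaSize (brecMaj h) := by
  obtain ⟨φ, hφ, hc, hsize⟩ := exists_isMonotone_size_eq_monotoneFormulaSize h
  obtain ⟨ι, _, ℓ, v, hcard, hsep, hrect⟩ := φ.exists_rectangle_labelling hφ
  have ht (s : Fin h → Fin 3) : φ.eval (avoidingInput true s) = true :=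
    (hc _).trans (brecMaj_avoidingInput true s)
  have hf (s : Fin h → Fin 3) : φ.eval (avoidingInput false s) = false :=
    (hc _).trans (brecMaj_avoidingInput false s)
  rw [← hsize, ← hcard]
  refine le_card_of_rectangle_labelling
    (fun s t => ℓ (avoidingInput true s) (avoidingInput false t))
    (fun r => ternaryDigits h (v r)) (fun s t j => ?_)
    fun s s' t t' => hrect _ _ _ _ (ht s) (ht s') (hf t) (hf t')
  have := hsep _ _ (ht s) (hf t)
  exact ⟨(avoidingInput_eq_iff _ _ _).1 this.1 j, (avoidingInput_eq_iff _ _ _).1 this.2 j⟩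

theorem mainTheorem3 (h : ℕ) (hh : 2 ≤ h) :
    (4 : ℝ) ^ h + 13 / 36 * (8 / 3 : ℝ) ^ h ≤ (monotoneFormulaSize (brecMaj h) : ℝ) := by
  have hle := le_monotoneFormulaSize_brecMaj h
  -- For `h = 2` the coefficient `h / 6 = 1 / 3` is below `13 / 36`, but the bound exceeds 18, so
  -- integrality gives 19, which suffices.
  rcases hh.eq_or_lt with rfl | hh
  · have h18 : 18 < monotoneFormulaSize (brecMaj 2) := by
      have : (18 : ℝ) < monotoneFormulaSize (brecMaj 2) := lt_of_lt_of_le (by norm_num) hle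
      exact_mod_cast this
    have h19 : (19 : ℝ) ≤ monotoneFormulaSize (brecMaj 2) := by exact_mod_cast h18
    exact le_trans (by norm_num) h19
  · refine le_trans ?_ hle
    have h3 : (3 : ℝ) ≤ h := by exact_mod_cast hh
    have hcoef : (13 : ℝ) / 36 ≤ h / 6 := by linarith
    gcongr
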